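/- Let $R$ be a two-sided noetherian ring, let $\operatorname{proj} R$ be the category of finitely generated projective right $R$-modules, and let $\mathcal{K}(R)=\mathcal{K}(\operatorname{proj} R)$ be the (triangulated) homotopy category of (unbounded) cochain complexes over $\operatorname{proj} R$. For $X\in\mathcal{K}(R)$ let $C^i(X)$ be the cokernel of the differential $d_X^{i-1}\colon X^{i-1}\to X^i$, and let $X^\ast=\operatorname{Hom}_R(X,R)$ be the $R$-dual complex of left $R$-modules, with $(X^\ast)^i=\operatorname{Hom}_R(X^{-i},R)$. A morphism $f$ of $\mathcal{K}(R)$ is *cohomologically surjective* if $\mathrm{H}^i(f)$ is surjective for all $i\in\mathbb{Z}$. A distinguished triangle $A\to B\to C\to A[1]$ in $\mathcal{K}(R)$ is *cohomologically ghost* if $0\to \mathrm{H}^i(A)\to \mathrm{H}^i(B)\to \mathrm{H}^i(C)\to 0$ is exact for all $i\in\mathbb{Z}$. A complex $X\in\mathcal{K}(R)$ is *split* if there are $R$-homomorphisms $s^{i}\colon X^{i}\to X^{i-1}$ $(i\in\mathbb{Z})$ with $d_X^i s^{i+1} d_X^i=d_X^i$ for all $i$. It is *Gorenstein projective* if $\operatorname{Ext}^j_R(C^i(X),R)=0$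 and $\operatorname{Ext}^j_{R^{\mathrm{op}}}(C^i(X^\ast),R)=0$ for all $i\in\mathbb{Z}$ and all $j>0$. The *projective dimension* $\operatorname{pd}_R X$ (respectively the *Gorenstein dimension* $\operatorname{G-dim}_R X$) is the infimum in $\mathbb{N}\cup\{\infty\}$ of the integers $n\ge 0$ for which there are distinguished triangles $X_{i+1}\to G_i\xrightarrow{f_i}X_i\to X_{i+1}[1]$ in $\mathcal{K}(R)$ for $0\le i\le n-1$, with every $G_i$ split (respectively Gorenstein projective) and every $f_i$ cohomologically surjective, such that $X_0\cong X$ in $\mathcal{K}(R)$ and $X_n$ is split (respectively Gorenstein projective). Let $X\in\mathcal{K}(R)$. Then $\operatorname{G-dim}_R X<\infty$ if and only if there exists a cohomologically ghost triangle $Y\to G\to X\to Y[1]$ in $\mathcal{K}(R)$ such that $\operatorname{pd}_R Y<\infty$ and $G$ is Gorenstein projective. -/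

import Mathlib

open CategoryTheory Limits
open scoped ZeroObject Pretriangulated

universe u

namespace StableComplex

noncomputable section

/-- The property of a (left) `S`-module of being finitely generated and projective. -/
def finProj (S : Type u) [Ring S] : ObjectProperty (ModuleCat.{u} S) :=
  fun M => Module.Finite S M ∧ Module.Projective S M

instance (S : Type u) [Ring S] : (finProj S).ContainsZero where
  exists_zero :=
    ⟨ModuleCat.of S PUnit.{u + 1}, ModuleCat.isZero_of_subsingleton _,
      inferInstanceAs (Module.Finite S PUnit.{u + 1}),
      inferInstanceAs (Module.Projective S PUnit.{u + 1})⟩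

theorem finProj_biprod (S : Type u) [Ring S] {M N : ModuleCat.{u} S}
    (hM : finProj S M) (hN : finProj S N) : finProj S (ModuleCat.of S (M × N)) := by
  obtain ⟨_, _⟩ := hM
  obtain ⟨_, _⟩ := hN
  exact ⟨inferInstanceAs (Module.Finite S (M × N)), inferInstanceAs (Module.Projective S (M × N))⟩

/-- `proj R`: finitely generated projective right `R`-modules. Right `R`-modules are
modules over the opposite ring `Rᵐᵒᵖ`. -/
abbrev ProjCat (R : Type u) [Ring R] := (finProj Rᵐᵒᵖ).FullSubcategory

instance (R : Type u) [Ring R] : HasBinaryBiproducts (ProjCat R) where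
  has_binary_biproduct M N := by
    let P : ProjCat R := ⟨_, finProj_biprod Rᵐᵒᵖ M.property N.property⟩
    exact HasBinaryBiproduct.mk
      { bicone :=
          { pt := P
            fst := ObjectProperty.homMk (ModuleCat.ofHom (LinearMap.fst Rᵐᵒᵖ M.obj N.obj))
            snd := ObjectProperty.homMk (ModuleCat.ofHom (LinearMap.snd Rᵐᵒᵖ M.obj N.obj))
            inl := ObjectProperty.homMk (ModuleCat.ofHom (LinearMap.inl Rᵐᵒᵖ M.obj N.obj))
            inr := ObjectProperty.homMk (ModuleCat.ofHom (LinearMap.inr Rᵐᵒᵖ M.obj N.obj))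
            inl_fst := by ext x; rfl
            inl_snd := by ext x; rfl
            inr_fst := by ext x; rfl
            inr_snd := by ext x; rfl }
        isBilimit := isBinaryBilimitOfTotal _ (by
          apply ObjectProperty.hom_ext
          apply ModuleCat.hom_ext
          apply LinearMap.ext
          rintro ⟨x, y⟩
          exact Prod.ext (add_zero x) (zero_add y)) }

/-- The homotopy category `K(proj R)` of (unbounded, cohomologically indexed) complexes of finitely
generated projective right `R`-modules. It carries Mathlib's triangulated structure. -/
abbrev KProj (R : Type u) [Ring R] := HomotopyCategory (ProjCat R) (ComplexShape.up ℤ)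

variable {R : Type u} [Ring R]

/-- The inclusion of `proj R` in the category of all right `R`-modules. -/
abbrev incl (R : Type u) [Ring R] : ProjCat R ⥤ ModuleCat.{u} Rᵐᵒᵖ := (finProj Rᵐᵒᵖ).ι

/-- The underlying complex of right `R`-modules of an object of `K(proj R)`. -/
def toComplex (X : KProj R) : CochainComplex (ModuleCat.{u} Rᵐᵒᵖ) ℤ :=
  ((incl R).mapHomologicalComplex (ComplexShape.up ℤ)).obj X.as

/-- The `i`th cohomology functor on `K(proj R)`, with values in right `R`-modules. -/
def coh (R : Type u) [Ring R] (i : ℤ) : KProj R ⥤ ModuleCat.{u} Rᵐᵒᵖ :=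
  (incl R).mapHomotopyCategory (ComplexShape.up ℤ) ⋙
    HomotopyCategory.homologyFunctor (ModuleCat.{u} Rᵐᵒᵖ) (ComplexShape.up ℤ) i

/-- `C^i(X)`, the cokernel of the differential `X^{i-1} ⟶ X^i`. -/
def coker {S : Type u} [Ring S] (X : CochainComplex (ModuleCat.{u} S) ℤ) (i : ℤ) :
    ModuleCat.{u} S :=
  cokernel (X.d (i - 1) i)

/-- The `R`-dual `X^* = Hom_R(X, R)`, a complex of left `R`-modules: `(X^*)^i = Hom_R(X^{-i}, R)`,
where `R` acts on values on the left, and the differentials are given by precomposition. -/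
def dual (X : KProj R) : CochainComplex (ModuleCat.{u} R) ℤ where
  X i := ModuleCat.of R ((toComplex X).X (-i) →ₗ[Rᵐᵒᵖ] R)
  d i j := ModuleCat.ofHom
    { toFun := fun φ => φ ∘ₗ ((toComplex X).d (-j) (-i)).hom
      map_add' := fun _ _ => rfl
      map_smul' := fun _ _ => rfl }
  shape i j hij := by
    have h : (toComplex X).d (-j) (-i) = 0 :=
      (toComplex X).shape _ _ (fun h => hij (by simp only [ComplexShape.up_Rel] at *; omega))
    ext φ
    simp [h]
  d_comp_d' i j k _ _ := by
    ext φ x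
    have h := (toComplex X).d_comp_d (-k) (-j) (-i)
    exact (congrArg (fun f => φ (f.hom x)) h).trans (map_zero φ)

/-- `X` is split: there are `R`-linear maps `s^{i+1} : X^{i+1} ⟶ X^i` with `d s d = d`. -/
def IsSplit (X : KProj R) : Prop :=
  ∃ s : ∀ i : ℤ, X.as.X (i + 1) ⟶ X.as.X i,
    ∀ i : ℤ, X.as.d i (i + 1) ≫ s i ≫ X.as.d i (i + 1) = X.as.d i (i + 1)

/-- `X` is Gorenstein projective: `Ext_R^j(C^i(X), R) = 0` (right modules) and
`Ext_{R^op}^j(C^i(X^*), R) = 0` (left modules) for all integers `i` and all `j > 0`. -/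
def IsGorensteinProjective (X : KProj R) : Prop :=
  ∀ (i : ℤ) (j : ℕ), 0 < j →
    Subsingleton (Abelian.Ext.{u} (coker (toComplex X) i) (ModuleCat.of Rᵐᵒᵖ R) j) ∧
    Subsingleton (Abelian.Ext.{u} (coker (dual X) i) (ModuleCat.of R R) j)

/-- A morphism of `K(proj R)` is cohomologically surjective if it is surjective on all
cohomology modules. -/
def CohSurjective {X Y : KProj R} (f : X ⟶ Y) : Prop :=
  ∀ i : ℤ, Function.Surjective ((coh R i).map f)

/-- `A --f--> B --g--> C --h--> A[1]` is a cohomologically ghost triangle: a distinguished triangle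
such that `0 ⟶ H^i(A) ⟶ H^i(B) ⟶ H^i(C) ⟶ 0` is exact for all integers `i`. -/
def IsCohGhostTriangle {A B C : KProj R} (f : A ⟶ B) (g : B ⟶ C) (h : C ⟶ A⟦(1 : ℤ)⟧) : Prop :=
  Pretriangulated.Triangle.mk f g h ∈ distTriang (KProj R) ∧
    ∀ i : ℤ, Function.Injective ((coh R i).map f) ∧
      Function.Exact ((coh R i).map f) ((coh R i).map g) ∧
      Function.Surjective ((coh R i).map g)

/-- `X` has a resolution of length `n` by objects satisfying `P`: there are distinguished triangles
`X_{i+1} ⟶ G_i --f_i--> X_i ⟶ X_{i+1}[1]` for `0 ≤ i ≤ n - 1`, with `G_i` in `P` and `f_i`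
cohomologically surjective, such that `X_0 ≅ X` and `X_n` is in `P`. -/
def HasResolution (P : KProj R → Prop) (X : KProj R) (n : ℕ) : Prop :=
  ∃ Z : ℕ → KProj R, Nonempty (Z 0 ≅ X) ∧ P (Z n) ∧
    ∀ i < n, ∃ (G : KProj R) (e : Z (i + 1) ⟶ G) (f : G ⟶ Z i) (h : Z i ⟶ (Z (i + 1))⟦(1 : ℤ)⟧),
      P G ∧ Pretriangulated.Triangle.mk e f h ∈ distTriang (KProj R) ∧ CohSurjective f

/-- The projective dimension of `X` (`⊤` if there is no finite resolution). -/
def projDim (X : KProj R) : ℕ∞ :=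
  sInf {d | ∃ n : ℕ, d = n ∧ HasResolution IsSplit X n}

/-- The Gorenstein dimension of `X` (`⊤` if there is no finite resolution). -/
def gorensteinDim (X : KProj R) : ℕ∞ :=
  sInf {d | ∃ n : ℕ, d = n ∧ HasResolution IsGorensteinProjective X n}

end

end StableComplex

/-! If `Y → G → X` is a ghost triangle, putting it in front of a split resolution of `Y` resolves
`X`, since split complexes are Gorenstein projective.

The other direction is an Auslander–Buchweitz style induction on the length of a resolution. Let `X₁
→ G₀ → X` be its first triangle and `Y₁ → G₁ → X₁` an approximation of `X₁`. Embed `G₁` in a split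
complex `P` with Gorenstein projective cone `G'` (`exists_split_embedding`). The cone `W` of `Y₁ →
P` has a finite split resolution, and an octahedron gives a triangle `X₁ → W → G'`. Pushing `X₁ → G₀
→ X` out along `X₁ → W` gives `W → E → X`; a second octahedron gives `G₀ → E → G'`, so `E` is
Gorenstein projective by `isGorensteinProjective_of_extension`.

The embedding comes from duality. Maps in `K(proj R)` to the complex with `R` in every degree and
zero differential form the product of the cohomology modules of the dual. Noetherianity supplies
finitely many generators of the dual cocycles in each degree; they assemble into a map from `G₁` to
a complex of free modules with zero differential. Vanishing of `Ext¹(Cⁱ(G₁^*), R)` makes this map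
injective on cohomology.

Closure properties are read off degreewise split sequences: injectivity on cohomology makes the
induced sequences of cokernels `Cⁱ` short exact, on both sides of the duality, and the long exact
sequence of `Ext` applies. -/

namespace StableComplex

noncomputable section

/-! ### Vanishing of higher `Ext` of modules -/

section ModuleExt

variable {S : Type u} [Ring S]

/-- All higher extension groups of `M` by `T` vanish. -/
def ExtVanish (M T : ModuleCat.{u} S) : Prop :=
  ∀ j : ℕ, 0 < j → Subsingleton (Abelian.Ext.{u} M T j)

theorem ExtVanish.of_projective {M : ModuleCat.{u} S} (hM : Module.Projective S M)
    (T : ModuleCat.{u} S) : ExtVanish M T := by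
  intro j hj
  have : Projective M := (IsProjective.iff_projective M).1 hM
  obtain ⟨k, rfl⟩ := Nat.exists_eq_succ_of_ne_zero hj.ne'
  exact Abelian.Ext.subsingleton_of_projective M T k

/-- The hypothesis exhibits `M` as a direct summand of `N ⊕ P`. In the application to homotopy
retracts, `P` is projective and absorbs a homotopy term. -/
theorem ExtVanish.of_factor {M N P T : ModuleCat.{u} S} (a : M ⟶ N) (b : N ⟶ M) (c : M ⟶ P)
    (e : P ⟶ M) (h : a ≫ b + c ≫ e = 𝟙 M) (hN : ExtVanish N T) (hP : ExtVanish P T) :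
    ExtVanish M T := by
  intro j hj
  have := hN j hj
  have := hP j hj
  refine subsingleton_of_forall_eq 0 fun x => ?_
  rw [← Abelian.Ext.mk₀_id_comp x, ← h, Abelian.Ext.mk₀_add, Abelian.Ext.add_comp,
    ← Abelian.Ext.mk₀_comp_mk₀_assoc a b x, ← Abelian.Ext.mk₀_comp_mk₀_assoc c e x,
    Subsingleton.elim ((Abelian.Ext.mk₀ b).comp x (zero_add j)) 0,
    Subsingleton.elim ((Abelian.Ext.mk₀ e).comp x (zero_add j)) 0]
  simp

theorem ExtVanish.of_iso {M N T : ModuleCat.{u} S} (e : M ≅ N) (hN : ExtVanish N T) :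
    ExtVanish M T :=
  ExtVanish.of_factor e.hom e.inv (0 : M ⟶ N) (0 : N ⟶ M) (by simp) hN hN

variable {E : ShortComplex (ModuleCat.{u} S)} {T : ModuleCat.{u} S}

theorem ExtVanish.mid (hE : E.ShortExact) (h₁ : ExtVanish E.X₁ T) (h₃ : ExtVanish E.X₃ T) :
    ExtVanish E.X₂ T := by
  intro j hj
  have := h₁ j hj
  have := h₃ j hj
  refine subsingleton_of_forall_eq 0 fun x => ?_
  obtain ⟨y, rfl⟩ := Abelian.Ext.contravariant_sequence_exact₂ hE T x (Subsingleton.elim _ _)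
  rw [Subsingleton.elim y 0, Abelian.Ext.comp_zero]

theorem ExtVanish.left (hE : E.ShortExact) (h₂ : ExtVanish E.X₂ T) (h₃ : ExtVanish E.X₃ T) :
    ExtVanish E.X₁ T := by
  intro j hj
  have := h₂ j hj
  have := h₃ (1 + j) (by omega)
  refine subsingleton_of_forall_eq 0 fun x => ?_
  obtain ⟨y, rfl⟩ := Abelian.Ext.contravariant_sequence_exact₁ hE T x rfl (Subsingleton.elim _ _)
  rw [Subsingleton.elim y 0, Abelian.Ext.comp_zero]

/-- Dimension shifting reaches only degrees `j ≥ 2`; in degree one the connecting map starts at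
`Hom(E.X₁, T)`, and `h` is what kills it. -/
theorem ExtVanish.right (hE : E.ShortExact) (h₁ : ExtVanish E.X₁ T) (h₂ : ExtVanish E.X₂ T)
    (h : ∀ φ : E.X₁ ⟶ T, ∃ ψ : E.X₂ ⟶ T, E.f ≫ ψ = φ) : ExtVanish E.X₃ T := by
  intro j hj
  have := h₂ j hj
  obtain ⟨k, rfl⟩ := Nat.exists_eq_add_of_le hj
  refine subsingleton_of_forall_eq 0 fun x => ?_
  obtain ⟨y, rfl⟩ := Abelian.Ext.contravariant_sequence_exact₃ hE T x
    (Subsingleton.elim _ _) (n₀ := k) (by omega)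
  obtain rfl | hk := Nat.eq_zero_or_pos k
  · obtain ⟨φ, rfl⟩ := Abelian.Ext.addEquiv₀.symm.surjective y
    obtain ⟨ψ, rfl⟩ := h φ
    have := hE.extClass_comp_assoc (Abelian.Ext.mk₀ ψ) (h := (rfl : 1 + 0 = 1))
    simpa using this
  · have := h₁ k hk
    rw [Subsingleton.elim y 0, Abelian.Ext.comp_zero]

theorem exists_extension_of_ext_one (hE : E.ShortExact)
    (h₃ : Subsingleton (Abelian.Ext.{u} E.X₃ T 1)) (φ : E.X₁ ⟶ T) :
    ∃ ψ : E.X₂ ⟶ T, E.f ≫ ψ = φ := by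
  obtain ⟨y, hy⟩ := Abelian.Ext.contravariant_sequence_exact₁ hE T (Abelian.Ext.mk₀ φ)
    (n₁ := 1) rfl (Subsingleton.elim _ _)
  obtain ⟨ψ, rfl⟩ := Abelian.Ext.addEquiv₀.symm.surjective y
  refine ⟨ψ, ?_⟩
  apply Abelian.Ext.addEquiv₀.symm.injective
  simpa using hy

theorem shortExact_of_linearMap {A B C : ModuleCat.{u} S} (f : A ⟶ B) (g : B ⟶ C) (w : f ≫ g = 0)
    (hf : Function.Injective f) (hfg : ∀ x, g x = 0 → ∃ y, f y = x) (hg : Function.Surjective g) :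
    (ShortComplex.mk f g w).ShortExact where
  exact := (ShortComplex.moduleCat_exact_iff _).2 hfg
  mono_f := (ModuleCat.mono_iff_injective _).2 hf
  epi_g := (ModuleCat.epi_iff_surjective _).2 hg

/-- If `Ext¹(coker d, T) = 0`, every map to `T` vanishing on the kernel of `d` factors
through `d`. -/
theorem exists_factor_of_ker_le {M N : ModuleCat.{u} S} (d : M ⟶ N)
    (h : Subsingleton (Abelian.Ext.{u} (ModuleCat.of S (N ⧸ LinearMap.range d.hom)) T 1))
    (φ : M ⟶ T) (hφ : ∀ x, d x = 0 → φ x = 0) : ∃ ψ : N ⟶ T, d ≫ ψ = φ := by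
  have hE : (ShortComplex.mk (ModuleCat.ofHom (LinearMap.range d.hom).subtype)
      (ModuleCat.ofHom (LinearMap.range d.hom).mkQ) (by ext x; simp)).ShortExact := by
    refine shortExact_of_linearMap _ _ _ Subtype.val_injective (fun x hx => ?_)
      (Submodule.mkQ_surjective _)
    exact ⟨⟨x, (Submodule.Quotient.mk_eq_zero _).1 hx⟩, rfl⟩
  have hk : LinearMap.ker d.hom ≤ LinearMap.ker φ.hom := hφ
  -- `φ` descends to `M / ker d ≅ range d`; the obstruction to extending it from `range d` to `N`
  -- lies in `Ext¹(coker d, T)`.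
  obtain ⟨ψ, hψ⟩ := exists_extension_of_ext_one hE h (ModuleCat.ofHom
    (((LinearMap.ker d.hom).liftQ φ.hom hk) ∘ₗ
      (LinearMap.quotKerEquivRange d.hom).symm.toLinearMap))
  refine ⟨ψ, ?_⟩
  ext x
  have := congrArg (fun f => f.hom ⟨d x, x, rfl⟩) hψ
  refine this.trans ?_
  have h2 : (LinearMap.quotKerEquivRange d.hom).symm ⟨d x, x, rfl⟩ = Submodule.Quotient.mk x := by
    rw [LinearEquiv.symm_apply_eq]; rfl
  change ((LinearMap.ker d.hom).liftQ φ.hom hk)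
    ((LinearMap.quotKerEquivRange d.hom).symm ⟨d x, x, rfl⟩) = _
  rw [h2]; rfl

end ModuleExt

/-! ### Cokernels of differentials -/

section Cokernel

variable {S : Type u} [Ring S]

/-- The cokernel of `K^{i-1} ⟶ K^i`, as a quotient module. -/
abbrev cq (K : CochainComplex (ModuleCat.{u} S) ℤ) (i : ℤ) : ModuleCat.{u} S :=
  ModuleCat.of S (K.X i ⧸ LinearMap.range (K.d (i - 1) i).hom)

def cokerIso (K : CochainComplex (ModuleCat.{u} S) ℤ) (i : ℤ) : coker K i ≅ cq K i :=
  ModuleCat.cokernelIsoRangeQuotient _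

variable {K L M : CochainComplex (ModuleCat.{u} S) ℤ}

theorem range_d_le_comap (f : K ⟶ L) (i : ℤ) : LinearMap.range (K.d (i - 1) i).hom ≤
    (LinearMap.range (L.d (i - 1) i).hom).comap (f.f i).hom := by
  rintro _ ⟨x, rfl⟩
  exact ⟨f.f _ x, congrArg (fun h => h.hom x) (f.comm (i - 1) i)⟩

/-- The map induced on cokernels of differentials. -/
def cqMap (f : K ⟶ L) (i : ℤ) : cq K i ⟶ cq L i :=
  ModuleCat.ofHom (Submodule.mapQ _ _ (f.f i).hom (range_d_le_comap f i))

theorem comm_apply (f : K ⟶ L) (i j : ℤ) (x : K.X i) : L.d i j (f.f i x) = f.f j (K.d i j x) :=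
  congrArg (fun h => h.hom x) (f.comm i j)

theorem d_d_apply (K : CochainComplex (ModuleCat.{u} S) ℤ) (i j k : ℤ) (x : K.X i) :
    K.d j k (K.d i j x) = 0 :=
  congrArg (fun h => h.hom x) (K.d_comp_d i j k)

/-- A degreewise short exact sequence of complexes whose first map is injective on cohomology
induces short exact sequences on the cokernels of the differentials. -/
theorem cq_shortExact (f : K ⟶ L) (g : L ⟶ M) (hf : ∀ i, Function.Injective (f.f i))
    (w : ∀ i x, g.f i (f.f i x) = 0) (hfg : ∀ i x, g.f i x = 0 → ∃ y, f.f i y = x)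
    (hg : ∀ i, Function.Surjective (g.f i)) (i : ℤ)
    (hH : ∀ x, K.d i (i + 1) x = 0 → (∃ y, L.d (i - 1) i y = f.f i x) →
      ∃ z, K.d (i - 1) i z = x) :
    ∃ h : cqMap f i ≫ cqMap g i = 0, (ShortComplex.mk (cqMap f i) (cqMap g i) h).ShortExact := by
  refine ⟨?_, shortExact_of_linearMap _ _ _ ?_ ?_ ?_⟩
  · ext x
    change (Submodule.Quotient.mk (g.f i (f.f i x)) : cq M i) = 0
    rw [w, Submodule.Quotient.mk_zero]
  · refine (injective_iff_map_eq_zero (cqMap f i).hom).2 fun x hx => ?_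
    obtain ⟨x, rfl⟩ := Submodule.mkQ_surjective _ x
    obtain ⟨y, hy⟩ := (Submodule.Quotient.mk_eq_zero _).1 hx
    -- `x` is a cocycle because its image is a boundary and `f` is injective one degree up.
    refine (Submodule.Quotient.mk_eq_zero _).2 (hH x (hf _ ?_) ⟨y, hy⟩)
    rw [map_zero, ← comm_apply]
    exact (congrArg _ hy.symm).trans (d_d_apply _ _ _ _ _)
  · intro x hx
    obtain ⟨x, rfl⟩ := Submodule.mkQ_surjective _ x
    obtain ⟨y, hy⟩ := (Submodule.Quotient.mk_eq_zero _).1 hx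
    obtain ⟨y, rfl⟩ := hg _ y
    obtain ⟨z, hz⟩ := hfg i (x - L.d (i - 1) i y) (by
      rw [map_sub, ← comm_apply]
      exact sub_eq_zero.2 hy.symm)
    refine ⟨Submodule.Quotient.mk z, ?_⟩
    refine (congrArg (Submodule.Quotient.mk (p := LinearMap.range (L.d (i - 1) i).hom)) hz).trans ?_
    exact (Submodule.Quotient.eq _).2 ⟨-y, by simp⟩
  · intro x
    obtain ⟨x, rfl⟩ := Submodule.mkQ_surjective _ x
    obtain ⟨y, rfl⟩ := hg _ x
    exact ⟨Submodule.Quotient.mk y, rfl⟩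

/-- Vanishing of the higher extension groups of all cokernels of differentials. -/
def CokerExtVanish (K : CochainComplex (ModuleCat.{u} S) ℤ) (T : ModuleCat.{u} S) : Prop :=
  ∀ i, ExtVanish (cq K i) T

/-- Modulo boundaries the term with `s` disappears, and the term with `t` factors through the
projective `K.X (i + 1)`. So each cokernel of `K` is a summand of that of `L` plus a projective. -/
theorem cokerExtVanish_of_retract {T : ModuleCat.{u} S} (f : K ⟶ L) (g : L ⟶ K)
    (hK : ∀ i, Module.Projective S (K.X i))
    (s : ∀ i, K.X i ⟶ K.X (i - 1)) (t : ∀ i, K.X (i + 1) ⟶ K.X i)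
    (h : ∀ i, f.f i ≫ g.f i + s i ≫ K.d (i - 1) i + K.d i (i + 1) ≫ t i = 𝟙 _)
    (hL : CokerExtVanish L T) : CokerExtVanish K T := by
  intro i
  refine ExtVanish.of_factor (cqMap f i) (cqMap g i)
    (ModuleCat.ofHom ((LinearMap.range (K.d (i - 1) i).hom).liftQ (K.d i (i + 1)).hom ?_))
    (t i ≫ ModuleCat.ofHom (LinearMap.range (K.d (i - 1) i).hom).mkQ) ?_ (hL i)
    (ExtVanish.of_projective (hK (i + 1)) T)
  · rintro _ ⟨x, rfl⟩
    exact d_d_apply _ _ _ _ _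
  · ext x
    change (Submodule.Quotient.mk (g.f i (f.f i x)) : cq K i) +
      Submodule.Quotient.mk (t i (K.d i (i + 1) x)) = Submodule.Quotient.mk x
    rw [← Submodule.Quotient.mk_add, Submodule.Quotient.eq]
    refine ⟨- s i x, ?_⟩
    have := congrArg (fun f => f.hom x) (h i)
    change g.f i (f.f i x) + K.d (i - 1) i (s i x) + t i (K.d i (i + 1) x) = x at this
    change K.d (i - 1) i (- s i x) = _
    rw [map_neg]
    refine (sub_eq_of_eq_add ?_).symm
    refine Eq.trans ?_ (congrArg (fun y => -K.d (i - 1) i (s i x) + y) this)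
    abel

/-- The map `x ↦ x - d (s x)` kills boundaries and induces a section of `Kⁱ → Cⁱ(K)`, so the
cokernels are projective. -/
theorem cokerExtVanish_of_split {T : ModuleCat.{u} S}
    (hK : ∀ i, Module.Projective S (K.X i)) (s : ∀ i, K.X i ⟶ K.X (i - 1))
    (h : ∀ i, K.d (i - 1) i ≫ s i ≫ K.d (i - 1) i = K.d (i - 1) i) : CokerExtVanish K T := by
  intro i
  refine ExtVanish.of_factor (N := K.X i) (P := K.X i)
    (ModuleCat.ofHom ((LinearMap.range (K.d (i - 1) i).hom).liftQ
      (𝟙 _ - s i ≫ K.d (i - 1) i : K.X i ⟶ K.X i).hom ?_))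
    (ModuleCat.ofHom (LinearMap.range (K.d (i - 1) i).hom).mkQ) 0 0 ?_
    (ExtVanish.of_projective (hK i) T) (ExtVanish.of_projective (hK i) T)
  · rintro _ ⟨x, rfl⟩
    have := congrArg (fun f => f.hom x) (h i)
    exact sub_eq_zero.2 this.symm
  · ext x
    simp only [comp_zero, add_zero]
    change (Submodule.Quotient.mk (x - K.d (i - 1) i (s i x)) : cq K i) = Submodule.Quotient.mk x
    rw [Submodule.Quotient.eq]
    exact ⟨- s i x, by simp⟩

theorem exists_factor_of_cocycles {T : ModuleCat.{u} S} (hK : CokerExtVanish K T) {i j : ℤ}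
    (hij : i + 1 = j) (φ : K.X i ⟶ T) (hφ : ∀ x, K.d i j x = 0 → φ x = 0) :
    ∃ ψ : K.X j ⟶ T, K.d i j ≫ ψ = φ := by
  obtain rfl : i = j - 1 := by omega
  exact exists_factor_of_ker_le _ (hK j 1 one_pos) φ hφ

end Cokernel

/-! ### Duals of finitely generated projective modules -/

section DualModule

variable {R : Type u} [Ring R]

/-- `R`, as a right module over itself, is isomorphic to `Rᵐᵒᵖ`. -/
def regularEquiv (R : Type u) [Ring R] : R ≃ₗ[Rᵐᵒᵖ] Rᵐᵒᵖ where
  toFun := MulOpposite.op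
  invFun := MulOpposite.unop
  map_add' _ _ := rfl
  map_smul' _ _ := rfl
  left_inv _ := rfl
  right_inv _ := rfl

/-- The free right `R`-module of rank `n`. -/
def freeObj (R : Type u) [Ring R] (n : ℕ) : ProjCat R where
  obj := ModuleCat.of Rᵐᵒᵖ (Fin n → R)
  property := by
    have : Module.Finite Rᵐᵒᵖ R := Module.Finite.equiv (regularEquiv R).symm
    exact ⟨inferInstanceAs (Module.Finite Rᵐᵒᵖ (Fin n → R)),
      Module.Projective.of_equiv (LinearEquiv.piCongrRight fun _ : Fin n => (regularEquiv R).symm)⟩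

/-- The right `R`-module `R`. -/
def regularObj (R : Type u) [Ring R] : ProjCat R where
  obj := ModuleCat.of Rᵐᵒᵖ R
  property := ⟨Module.Finite.equiv (regularEquiv R).symm,
    Module.Projective.of_equiv (regularEquiv R).symm⟩

section

variable {M : Type u} [AddCommGroup M] [Module Rᵐᵒᵖ M]

theorem exists_dual_basis [Module.Finite Rᵐᵒᵖ M] [Module.Projective Rᵐᵒᵖ M] :
    ∃ (n : ℕ) (e : Fin n → M) (φ : Fin n → M →ₗ[Rᵐᵒᵖ] R),
      ∀ m, ∑ k, MulOpposite.op (φ k m) • e k = m := by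
  obtain ⟨n, p, hp⟩ := Module.Finite.exists_fin' Rᵐᵒᵖ M
  obtain ⟨s, hs⟩ := Module.projective_lifting_property p LinearMap.id hp
  refine ⟨n, fun k => p (Pi.single k 1),
    fun k => (regularEquiv R).symm.toLinearMap ∘ₗ LinearMap.proj k ∘ₗ s, fun m => ?_⟩
  have h : p (s m) = m := congrArg (fun f => f m) hs
  conv_rhs => rw [← h, ← Finset.univ_sum_single (s m), map_sum]
  refine Finset.sum_congr rfl fun k _ => ?_
  rw [← map_smul]
  congr 1
  ext l
  simp only [Pi.smul_apply, Pi.single_apply, smul_eq_mul, mul_ite, mul_one, mul_zero]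
  rfl

theorem dual_eq_sum {n : ℕ} {e : Fin n → M} {φ : Fin n → M →ₗ[Rᵐᵒᵖ] R}
    (h : ∀ m, ∑ k, MulOpposite.op (φ k m) • e k = m) (ψ : M →ₗ[Rᵐᵒᵖ] R) :
    ∑ k, ψ (e k) • φ k = ψ := by
  ext m
  conv_rhs => rw [← h m]
  simp

theorem projective_dual [Module.Finite Rᵐᵒᵖ M] [Module.Projective Rᵐᵒᵖ M] :
    Module.Projective R (M →ₗ[Rᵐᵒᵖ] R) := by
  obtain ⟨n, e, φ, h⟩ := exists_dual_basis (R := R) (M := M)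
  refine Module.Projective.of_split (M := Fin n → R)
    { toFun := fun ψ k => ψ (e k), map_add' := fun _ _ => rfl, map_smul' := fun _ _ => rfl }
    (Fintype.linearCombination R φ) ?_
  ext1 ψ
  exact dual_eq_sum h ψ

/-- Every functional on the dual of a finitely generated projective module is an evaluation. -/
theorem exists_eval_eq [Module.Finite Rᵐᵒᵖ M] [Module.Projective Rᵐᵒᵖ M]
    (Φ : (M →ₗ[Rᵐᵒᵖ] R) →ₗ[R] R) : ∃ y : M, ∀ ψ, Φ ψ = ψ y := by
  obtain ⟨n, e, φ, h⟩ := exists_dual_basis (R := R) (M := M)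
  refine ⟨∑ k, MulOpposite.op (Φ (φ k)) • e k, fun ψ => ?_⟩
  conv_lhs => rw [← dual_eq_sum h ψ]
  simp

theorem eq_of_forall_dual [Module.Finite Rᵐᵒᵖ M] [Module.Projective Rᵐᵒᵖ M] {x y : M}
    (hxy : ∀ φ : M →ₗ[Rᵐᵒᵖ] R, φ x = φ y) : x = y := by
  obtain ⟨n, e, φ, h⟩ := exists_dual_basis (R := R) (M := M)
  rw [← h x, ← h y]
  simp only [hxy]

/-- A functional is determined by its values on `n` generators, so the dual embeds in the left
module `Rⁿ`. -/
theorem isNoetherian_dual [IsNoetherianRing R] [Module.Finite Rᵐᵒᵖ M] :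
    IsNoetherian R (M →ₗ[Rᵐᵒᵖ] R) := by
  obtain ⟨n, p, hp⟩ := Module.Finite.exists_fin' Rᵐᵒᵖ M
  let ev : (M →ₗ[Rᵐᵒᵖ] R) →ₗ[R] (Fin n → R) :=
    { toFun := fun ψ k => ψ (p (Pi.single k 1))
      map_add' := fun _ _ => rfl
      map_smul' := fun _ _ => rfl }
  refine isNoetherian_of_injective ev fun ψ χ h => ?_
  ext m
  obtain ⟨v, rfl⟩ := hp m
  have : ψ ∘ₗ p = χ ∘ₗ p := by
    refine LinearMap.pi_ext' fun k => LinearMap.ext_ring ?_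
    exact congrFun h k
  exact congrArg (fun f => f v) this

end

/-- The transpose of a linear map. -/
def transpose {M N : ModuleCat.{u} Rᵐᵒᵖ} (f : M ⟶ N) :
    ModuleCat.of R (N →ₗ[Rᵐᵒᵖ] R) ⟶ ModuleCat.of R (M →ₗ[Rᵐᵒᵖ] R) :=
  ModuleCat.ofHom
    { toFun := fun φ => φ ∘ₗ f.hom
      map_add' := fun _ _ => rfl
      map_smul' := fun _ _ => rfl }

end DualModule

/-! ### Homotopy invariance, split complexes, and complexes with zero differential -/

section Complexes

variable {R : Type u} [Ring R]

/-- Complexes of finitely generated projective right modules. -/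
abbrev ProjCx (R : Type u) [Ring R] := CochainComplex (ProjCat R) ℤ

/-- The functor to the homotopy category. -/
abbrev toK (R : Type u) [Ring R] : ProjCx R ⥤ KProj R :=
  HomotopyCategory.quotient (ProjCat R) (ComplexShape.up ℤ)

/-- The functor to complexes of right modules. -/
abbrev toMod (R : Type u) [Ring R] :
    ProjCx R ⥤ CochainComplex (ModuleCat.{u} Rᵐᵒᵖ) ℤ :=
  (incl R).mapHomologicalComplex (ComplexShape.up ℤ)

/-- The dual complex. -/
abbrev dualCx (X : ProjCx R) : CochainComplex (ModuleCat.{u} R) ℤ := dual ((toK R).obj X)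

variable {X Y : ProjCx R}

/-- The chain map dual to a chain map. -/
def dualMap (f : X ⟶ Y) : dualCx Y ⟶ dualCx X where
  f i := transpose (f.f (-i)).hom
  comm' i j _ := by
    ext φ
    refine LinearMap.ext fun x => ?_
    let φ' : (Y.X (-i)).obj →ₗ[Rᵐᵒᵖ] R := φ
    exact congrArg φ' (comm_apply ((toMod R).map f) (-j) (-i) x).symm

theorem isGorensteinProjective_iff (X : ProjCx R) : IsGorensteinProjective ((toK R).obj X) ↔
    CokerExtVanish ((toMod R).obj X) (ModuleCat.of Rᵐᵒᵖ R) ∧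
      CokerExtVanish (dualCx X) (ModuleCat.of R R) := by
  constructor
  · intro h
    exact ⟨fun i => ExtVanish.of_iso (cokerIso _ i).symm fun j hj => (h i j hj).1,
      fun i => ExtVanish.of_iso (cokerIso _ i).symm fun j hj => (h i j hj).2⟩
  · rintro ⟨h₁, h₂⟩ i j hj
    exact ⟨ExtVanish.of_iso (cokerIso _ i) (h₁ i) j hj,
      ExtVanish.of_iso (cokerIso _ i) (h₂ i) j hj⟩

theorem projective_toMod (X : ProjCx R) (i : ℤ) :
    Module.Projective Rᵐᵒᵖ (((toMod R).obj X).X i) := (X.X i).property.2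

theorem projective_dualCx (X : ProjCx R) (i : ℤ) : Module.Projective R ((dualCx X).X i) := by
  exact @projective_dual R _ (X.X (-i)).obj _ _ (X.X (-i)).property.1 (X.X (-i)).property.2

/-- A homotopy retraction dualizes to a homotopy retraction with `f` and `g` exchanged, so both
conditions pass from `Y` to `X`. -/
theorem isGorensteinProjective_of_homotopy (f : X ⟶ Y) (g : Y ⟶ X) (H : Homotopy (f ≫ g) (𝟙 X))
    (hY : IsGorensteinProjective ((toK R).obj Y)) :
    IsGorensteinProjective ((toK R).obj X) := by
  rw [isGorensteinProjective_iff] at hY ⊢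
  -- The neighbouring degrees are free variables because the dual complex needs this at `-i`, with
  -- neighbours `-(i - 1)` and `-(i + 1)`.
  have key : ∀ i j k : ℤ, i + 1 = j → k + 1 = i → ∀ x : (X.X i).obj,
      (g.f i).hom ((f.f i).hom x) = (H.hom j i).hom ((X.d i j).hom x) +
        (X.d k i).hom ((H.hom i k).hom x) + x := by
    intro i j k hj hk x
    have h := H.comm i
    rw [dNext_eq H.hom (show (ComplexShape.up ℤ).Rel i j from hj),
      prevD_eq H.hom (show (ComplexShape.up ℤ).Rel k i from hk)] at h
    exact congrArg (fun f => f.hom.hom x) h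
  refine ⟨cokerExtVanish_of_retract ((toMod R).map f) ((toMod R).map g) (projective_toMod X)
    (fun i => -(H.hom i (i - 1)).hom) (fun i => -(H.hom (i + 1) i).hom) (fun i => ?_) hY.1,
    cokerExtVanish_of_retract (dualMap g) (dualMap f) (projective_dualCx X)
    (fun i => -transpose (H.hom (-(i - 1)) (-i)).hom)
    (fun i => -transpose (H.hom (-i) (-(i + 1))).hom) (fun i => ?_) hY.2⟩
  · ext x
    have h := key i (i + 1) (i - 1) rfl (by omega) x
    change (g.f i).hom ((f.f i).hom x) + (X.d (i - 1) i).hom (-(H.hom i (i - 1)).hom x) +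
      - (H.hom (i + 1) i).hom ((X.d i (i + 1)).hom x) = x
    rw [h, map_neg]
    abel
  · ext φ
    refine LinearMap.ext fun (x : (X.X (-i)).obj) => ?_
    let φ' : (X.X (-i)).obj →ₗ[Rᵐᵒᵖ] R := φ
    have h := congrArg φ' (key (-i) (-(i - 1)) (-(i + 1)) (by omega) (by omega) x)
    change φ' ((g.f (-i)).hom ((f.f (-i)).hom x)) +
      - φ' ((H.hom (-(i - 1)) (-i)).hom ((X.d (-i) (-(i - 1))).hom x)) +
      - φ' ((X.d (-(i + 1)) (-i)).hom ((H.hom (-i) (-(i + 1))).hom x)) = φ' x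
    rw [h, map_add, map_add]
    abel

theorem isGorensteinProjective_of_iso {X Y : KProj R} (e : X ≅ Y)
    (hY : IsGorensteinProjective Y) : IsGorensteinProjective X := by
  obtain ⟨X, rfl⟩ := HomotopyCategory.quotient_obj_surjective X
  obtain ⟨Y, rfl⟩ := HomotopyCategory.quotient_obj_surjective Y
  obtain ⟨H⟩ : Nonempty (HomotopyEquiv X Y) := ⟨HomotopyCategory.homotopyEquivOfIso e⟩
  exact isGorensteinProjective_of_homotopy H.hom H.inv H.homotopyHomInvId hY

theorem isGorensteinProjective_of_isSplit {X : KProj R} (hX : IsSplit X) :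
    IsGorensteinProjective X := by
  obtain ⟨X, rfl⟩ := HomotopyCategory.quotient_obj_surjective X
  obtain ⟨s, hs⟩ := hX
  have h : ∀ i j : ℤ, i + 1 = j → ∃ s : X.X j ⟶ X.X i, X.d i j ≫ s ≫ X.d i j = X.d i j := by
    rintro i _ rfl
    exact ⟨s i, hs i⟩
  rw [isGorensteinProjective_iff]
  choose s hs using fun i => h (i - 1) i (by omega)
  choose t ht using fun i => h (-i) (-(i - 1)) (by omega)
  refine ⟨cokerExtVanish_of_split (projective_toMod X) (fun i => (s i).hom) fun i => ?_,
    cokerExtVanish_of_split (projective_dualCx X) (fun i => transpose (t i).hom) fun i => ?_⟩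
  · exact congrArg (fun f => f.hom) (hs i)
  · ext φ
    refine LinearMap.ext fun x => ?_
    let φ' : (X.X (-(i - 1))).obj →ₗ[Rᵐᵒᵖ] R := φ
    exact congrArg (fun f => φ' (f.hom.hom x)) (ht i)

/-- The complex with zero differentials and the given terms. -/
def zeroD (M : ℤ → ProjCat R) : ProjCx R where
  X := M
  d _ _ := 0

theorem isSplit_zeroD (M : ℤ → ProjCat R) : IsSplit ((toK R).obj (zeroD M)) :=
  ⟨fun _ => 0, fun _ => zero_comp⟩

/-- A chain map to a complex with zero differentials. -/
def toZeroD {M : ℤ → ProjCat R} (φ : ∀ n, X.X n ⟶ M n)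
    (h : ∀ i j, i + 1 = j → X.d i j ≫ φ j = 0) : X ⟶ zeroD M where
  f := φ
  comm' i j hij := comp_zero.trans (h i j hij).symm

/-- One of the two homotopy terms ends with the zero differential of the target; the conditions in
different degrees then become independent. -/
theorem toK_map_eq_zero_iff {M : ℤ → ProjCat R} (f : X ⟶ zeroD M) :
    (toK R).map f = 0 ↔ ∀ n, ∃ ψ : X.X (n + 1) ⟶ M n, X.d n (n + 1) ≫ ψ = f.f n := by
  rw [HomotopyCategory.quotient_map_eq_zero_iff]
  constructor
  · rintro ⟨H⟩ n
    refine ⟨H.hom (n + 1) n, ?_⟩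
    have h := H.comm n
    rw [dNext_eq H.hom (show (ComplexShape.up ℤ).Rel n (n + 1) from rfl),
      prevD_eq H.hom (show (ComplexShape.up ℤ).Rel (n - 1) n by simp)] at h
    have h0 : H.hom n (n - 1) ≫ (zeroD M).d (n - 1) n = 0 := comp_zero
    rw [h, h0]
    exact ((add_zero _).trans (add_zero _)).symm
  · intro h
    choose ψ hψ using h
    let c : ∀ i j, X.X i ⟶ (zeroD M).X j := fun i j =>
      if hij : j + 1 = i then (X.XIsoOfEq hij.symm).hom ≫ ψ j else 0
    refine ⟨⟨c, fun i j hij => dif_neg hij, fun n => ?_⟩⟩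
    rw [dNext_eq c (show (ComplexShape.up ℤ).Rel n (n + 1) from rfl),
      prevD_eq c (show (ComplexShape.up ℤ).Rel (n - 1) n by simp)]
    have h0 : c n (n - 1) ≫ (zeroD M).d (n - 1) n = 0 := comp_zero
    have h1 : c (n + 1) n = ψ n := by
      simp only [c, HomologicalComplex.XIsoOfEq, dite_true]
      exact Category.id_comp _
    rw [h0, h1]
    exact ((add_zero _).trans ((add_zero _).trans (hψ n))).symm

/-- The complex with zero differentials all of whose terms are `R`. -/
abbrev regularCx (R : Type u) [Ring R] : ProjCx R := zeroD fun _ => regularObj R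

theorem exists_iso_regularCx_shift :
    Nonempty ((regularCx R)⟦(1 : ℤ)⟧ ≅ regularCx R) :=
  ⟨HomologicalComplex.Hom.isoOfComponents (fun _ => Iso.refl _) (fun _ _ _ =>
    comp_zero.trans (Eq.symm ((congrArg (· ≫ _) (smul_zero _)).trans zero_comp)))⟩

end Complexes

/-! ### Cohomology in terms of cocycles and boundaries -/

section Classes

variable {S : Type u} [Ring S] {K L : CochainComplex (ModuleCat.{u} S) ℤ}

/-- The cohomology class of a cocycle. -/
def cocycleClass (K : CochainComplex (ModuleCat.{u} S) ℤ) (i : ℤ) :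
    ModuleCat.of S (LinearMap.ker (K.d i (i + 1)).hom) ⟶ K.homology i :=
  K.liftCycles (ModuleCat.ofHom (LinearMap.ker (K.d i (i + 1)).hom).subtype) (i + 1) (by simp)
    (by ext x; exact x.2) ≫ K.homologyπ i

theorem cocycleClass_naturality (f : K ⟶ L) (i : ℤ) (x : LinearMap.ker (K.d i (i + 1)).hom)
    (y : LinearMap.ker (L.d i (i + 1)).hom) (h : y.1 = f.f i x.1) :
    HomologicalComplex.homologyMap f i (cocycleClass K i x) = cocycleClass L i y := by
  let g : ModuleCat.of S (LinearMap.ker (K.d i (i + 1)).hom) ⟶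
      ModuleCat.of S (LinearMap.ker (L.d i (i + 1)).hom) :=
    ModuleCat.ofHom ((f.f i).hom.restrict fun z hz => by
      change L.d i (i + 1) (f.f i z) = 0
      rw [comm_apply]
      exact (congrArg _ hz).trans (map_zero _))
  have : cocycleClass K i ≫ HomologicalComplex.homologyMap f i = g ≫ cocycleClass L i := by
    unfold cocycleClass
    rw [Category.assoc, HomologicalComplex.homologyπ_naturality, ← Category.assoc,
      ← Category.assoc]
    congr 1
    rw [← cancel_mono (L.iCycles i)]
    simp only [Category.assoc, HomologicalComplex.cyclesMap_i, HomologicalComplex.liftCycles_i,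
      HomologicalComplex.liftCycles_i_assoc]
    rfl
  refine (congrArg (fun f => f.hom x) this).trans ?_
  change cocycleClass L i (g x) = _
  congr 1
  exact Subtype.ext h.symm

theorem pOpcycles_eq_zero_iff (i : ℤ) (x : K.X i) :
    K.pOpcycles i x = 0 ↔ ∃ y, K.d (i - 1) i y = x := by
  have h : (ShortComplex.mk (K.d (i - 1) i) (K.pOpcycles i) (by simp)).Exact :=
    ShortComplex.exact_of_g_is_cokernel _ (K.opcyclesIsCokernel (i - 1) i (by simp))
  constructor
  · intro hx
    exact (ShortComplex.moduleCat_exact_iff _).1 h x hx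
  · rintro ⟨y, rfl⟩
    exact congrArg (fun f => f.hom y) (K.d_pOpcycles (i - 1) i)

theorem homologyι_cocycleClass (i : ℤ) (x : LinearMap.ker (K.d i (i + 1)).hom) :
    K.homologyι i (cocycleClass K i x) = K.pOpcycles i x.1 := by
  have : cocycleClass K i ≫ K.homologyι i = ModuleCat.ofHom (LinearMap.ker (K.d i (i + 1)).hom).subtype ≫
      K.pOpcycles i := by
    simp [cocycleClass]
  exact congrArg (fun f => f.hom x) this

theorem cocycleClass_eq_zero_iff (i : ℤ) (x : LinearMap.ker (K.d i (i + 1)).hom) :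
    cocycleClass K i x = 0 ↔ ∃ y, K.d (i - 1) i y = x.1 := by
  rw [← pOpcycles_eq_zero_iff, ← homologyι_cocycleClass]
  exact ((injective_iff_map_eq_zero' (K.homologyι i).hom).1
    ((ModuleCat.mono_iff_injective _).1 inferInstance) _).symm

theorem cocycleClass_surjective (i : ℤ) : Function.Surjective (cocycleClass K i) := by
  intro z
  obtain ⟨c, rfl⟩ := (ModuleCat.epi_iff_surjective (K.homologyπ i)).1 inferInstance z
  have hc : K.d i (i + 1) (K.iCycles i c) = 0 :=
    congrArg (fun f => f.hom c) (K.iCycles_d i (i + 1))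
  refine ⟨⟨K.iCycles i c, hc⟩, ?_⟩
  refine (ModuleCat.mono_iff_injective (K.homologyι i)).1 inferInstance ?_
  rw [homologyι_cocycleClass]
  exact congrArg (fun f => f.hom c) (K.homology_π_ι i).symm

theorem injective_homologyMap_iff (f : K ⟶ L) (i : ℤ) :
    Function.Injective (HomologicalComplex.homologyMap f i) ↔
      ∀ x, K.d i (i + 1) x = 0 → (∃ y, L.d (i - 1) i y = f.f i x) →
        ∃ z, K.d (i - 1) i z = x := by
  have hmap : ∀ x, K.d i (i + 1) x = 0 → L.d i (i + 1) (f.f i x) = 0 := fun x hx => by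
    rw [comm_apply, hx, map_zero]
  constructor
  · intro h x hx hy
    refine (cocycleClass_eq_zero_iff i ⟨x, hx⟩).1 (h ?_)
    rw [map_zero, cocycleClass_naturality f i ⟨x, hx⟩ ⟨f.f i x, hmap x hx⟩ rfl]
    exact (cocycleClass_eq_zero_iff i _).2 hy
  · intro h
    refine (injective_iff_map_eq_zero (HomologicalComplex.homologyMap f i).hom).2 fun z hz => ?_
    obtain ⟨⟨x, hx⟩, rfl⟩ := cocycleClass_surjective i z
    refine (cocycleClass_eq_zero_iff i _).2 (h x hx ?_)
    refine (cocycleClass_eq_zero_iff i ⟨f.f i x, hmap x hx⟩).1 ?_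
    rw [← cocycleClass_naturality f i ⟨x, hx⟩ ⟨f.f i x, hmap x hx⟩ rfl]
    exact hz

theorem exists_of_homologyMap_eq_zero (f : K ⟶ L) (i : ℤ)
    (h : HomologicalComplex.homologyMap f i = 0) (x : K.X i) (hx : K.d i (i + 1) x = 0) :
    ∃ y, L.d (i - 1) i y = f.f i x := by
  have hfx : L.d i (i + 1) (f.f i x) = 0 := by rw [comm_apply, hx, map_zero]
  refine (cocycleClass_eq_zero_iff i ⟨f.f i x, hfx⟩).1 ?_
  rw [← cocycleClass_naturality f i ⟨x, hx⟩ ⟨f.f i x, hfx⟩ rfl, h]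
  rfl

variable {R : Type u} [Ring R] {X Y : ProjCx R}

/-- The cohomology functor on the homotopy category is computed by chain complexes. -/
def cohIso (R : Type u) [Ring R] (i : ℤ) : toK R ⋙ coh R i ≅
    toMod R ⋙ HomologicalComplex.homologyFunctor (ModuleCat.{u} Rᵐᵒᵖ) (ComplexShape.up ℤ) i :=
  Functor.isoWhiskerLeft (toMod R) (HomotopyCategory.homologyFunctorFactors _ _ i)

theorem injective_coh_map_iff (f : X ⟶ Y) (i : ℤ) :
    Function.Injective ((coh R i).map ((toK R).map f)) ↔
      ∀ x, ((toMod R).obj X).d i (i + 1) x = 0 →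
        (∃ y, ((toMod R).obj Y).d (i - 1) i y = ((toMod R).map f).f i x) →
        ∃ z, ((toMod R).obj X).d (i - 1) i z = x := by
  rw [← injective_homologyMap_iff, ← ModuleCat.mono_iff_injective, ← ModuleCat.mono_iff_injective]
  exact (MorphismProperty.monomorphisms _).arrow_mk_iso_iff
    (((Functor.mapArrowFunctor _ _).mapIso (cohIso R i)).app (Arrow.mk f))

theorem exists_of_coh_map_eq_zero (f : X ⟶ Y) (i : ℤ) (h : (coh R i).map ((toK R).map f) = 0)
    (x : (X.X i).obj) (hx : (X.d i (i + 1)).hom x = 0) :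
    ∃ y, (Y.d (i - 1) i).hom y = (f.f i).hom x := by
  refine exists_of_homologyMap_eq_zero ((toMod R).map f) i ?_ x hx
  refine (NatIso.naturality_1 (cohIso R i) f).symm.trans ?_
  have h' : (toK R ⋙ coh R i).map f = 0 := h
  rw [h', zero_comp, comp_zero]
  rfl

end Classes

/-! ### Maps to the complex with `R` in every degree -/

section Detection

variable {R : Type u} [Ring R]

instance (i : ℤ) : (coh R i).IsHomological := by
  unfold coh
  infer_instance

/-- Every map from the source to a shift of `R` extends along `f`. -/
def DualSurj {A B : KProj R} (f : A ⟶ B) : Prop :=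
  ∀ φ : A ⟶ (toK R).obj (regularCx R), ∃ ψ : B ⟶ (toK R).obj (regularCx R), f ≫ ψ = φ

/-- Maps from the target to shifts of `R` are determined by their composition with `g`. -/
def DualInj {B C : KProj R} (g : B ⟶ C) : Prop :=
  ∀ φ : C ⟶ (toK R).obj (regularCx R), g ≫ φ = 0 → φ = 0

/-- A map killed by `g` factors through `h`. As `regularCx R` is isomorphic to its own shift, the
factor desuspends and extends along `f`; but `h` followed by the shift of `f` vanishes. -/
theorem DualSurj.dualInj {A B C : KProj R} {f : A ⟶ B} {g : B ⟶ C} {h : C ⟶ A⟦(1 : ℤ)⟧}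
    (hT : Pretriangulated.Triangle.mk f g h ∈ distTriang (KProj R)) (hf : DualSurj f) :
    DualInj g := by
  intro φ hφ
  obtain ⟨χ, rfl⟩ := Pretriangulated.Triangle.yoneda_exact₃ _ hT φ hφ
  obtain ⟨e₀⟩ := exists_iso_regularCx_shift (R := R)
  let e : ((toK R).obj (regularCx R))⟦(1 : ℤ)⟧ ≅ (toK R).obj (regularCx R) :=
    (((toK R).commShiftIso (1 : ℤ)).app (regularCx R)).symm ≪≫ (toK R).mapIso e₀
  obtain ⟨χ', hχ'⟩ := (shiftFunctor (KProj R) (1 : ℤ)).map_surjective (χ ≫ e.inv)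
  obtain ⟨ψ, rfl⟩ := hf χ'
  have hχ : χ = f⟦(1 : ℤ)⟧' ≫ ψ⟦(1 : ℤ)⟧' ≫ e.hom := by
    rw [← Category.assoc, ← Functor.map_comp]
    exact ((Iso.eq_comp_inv e).1 hχ').symm
  have h0 : h ≫ f⟦(1 : ℤ)⟧' = 0 := Pretriangulated.comp_distTriang_mor_zero₃₁ _ hT
  change h ≫ χ = 0
  rw [hχ, ← Category.assoc, h0, zero_comp]

variable {X Y : ProjCx R}

theorem update_comp_eq_zero {k : ℤ} (φ : X.X k ⟶ regularObj R)
    (hφ : ∀ l, l + 1 = k → X.d l k ≫ φ = 0) (i j : ℤ) (hij : i + 1 = j) :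
    X.d i j ≫ Function.update (fun n => (0 : X.X n ⟶ regularObj R)) k φ j = 0 := by
  by_cases hj : j = k
  · subst hj
    rw [Function.update_self]
    exact hφ i hij
  · rw [Function.update_of_ne hj, comp_zero]

/-- This is injectivity of `f^*` on the cohomology of the duals in one degree, obtained by extending
`φ` by zero to a chain map. -/
theorem DualInj.exists_factor {f : X ⟶ Y} (hf : DualInj ((toK R).map f)) {k j : ℤ}
    (hkj : k + 1 = j) (φ : Y.X k ⟶ regularObj R) (hφ : ∀ l, l + 1 = k → Y.d l k ≫ φ = 0)
    (ψ : X.X j ⟶ regularObj R) (h : X.d k j ≫ ψ = f.f k ≫ φ) :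
    ∃ χ : Y.X j ⟶ regularObj R, Y.d k j ≫ χ = φ := by
  subst hkj
  let Φ : Y ⟶ regularCx R := toZeroD _ (update_comp_eq_zero φ hφ)
  have hk : Φ.f k = φ :=
    Function.update_self (β := fun n => Y.X n ⟶ regularObj R) k φ 0
  have h0 : (toK R).map Φ = 0 := by
    refine hf _ ?_
    rw [← Functor.map_comp, toK_map_eq_zero_iff]
    intro n
    by_cases hn : n = k
    · subst hn
      exact ⟨ψ, h.trans (congrArg (f.f n ≫ ·) hk.symm)⟩
    · refine ⟨0, comp_zero.trans ?_⟩
      have : Φ.f n = 0 :=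
        Function.update_of_ne (β := fun n => Y.X n ⟶ regularObj R) hn φ 0
      exact ((congrArg (f.f n ≫ ·) this).trans comp_zero).symm
  obtain ⟨χ, hχ⟩ := (toK_map_eq_zero_iff Φ).1 h0 k
  exact ⟨χ, hχ.trans hk⟩

/-- This is surjectivity of `f^*` on the cohomology of the duals: a dual cocycle lifts up to a
coboundary, recorded by `θ`. -/
theorem DualSurj.exists_extension {f : X ⟶ Y} (hf : DualSurj ((toK R).map f)) (k : ℤ)
    (φ : X.X k ⟶ regularObj R) (hφ : ∀ l, l + 1 = k → X.d l k ≫ φ = 0) :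
    ∃ (ψ : Y.X k ⟶ regularObj R) (θ : X.X (k + 1) ⟶ regularObj R),
      (∀ l, l + 1 = k → Y.d l k ≫ ψ = 0) ∧ f.f k ≫ ψ + X.d k (k + 1) ≫ θ = φ := by
  let Φ : X ⟶ regularCx R := toZeroD _ (update_comp_eq_zero φ hφ)
  have hk : Φ.f k = φ :=
    Function.update_self (β := fun n => X.X n ⟶ regularObj R) k φ 0
  obtain ⟨ψ, hψ⟩ := hf ((toK R).map Φ)
  obtain ⟨Ψ, rfl⟩ := (toK R).map_surjective ψ
  have h0 : (toK R).map (Φ - f ≫ Ψ) = 0 := by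
    rw [Functor.map_sub, Functor.map_comp, hψ, sub_self]
  obtain ⟨θ, hθ⟩ := (toK_map_eq_zero_iff _).1 h0 k
  let ψ' : Y.X k ⟶ regularObj R := Ψ.f k
  refine ⟨ψ', θ, fun l hl => (Ψ.comm l k).symm.trans comp_zero, ?_⟩
  have : (Φ - f ≫ Ψ).f k = φ - f.f k ≫ ψ' := congrArg (· - f.f k ≫ ψ') hk
  rw [hθ.trans this]
  exact add_sub_cancel _ _

/-- Maps to shifts of `R` are detected by cohomology if `Ext¹(Cⁱ(X), R) = 0`. -/
theorem eq_zero_of_coh_map_eq_zero {X : KProj R} (hX : IsGorensteinProjective X)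
    (φ : X ⟶ (toK R).obj (regularCx R)) (h : ∀ i, (coh R i).map φ = 0) : φ = 0 := by
  obtain ⟨X, rfl⟩ := HomotopyCategory.quotient_obj_surjective X
  obtain ⟨Φ, rfl⟩ := (toK R).map_surjective φ
  rw [isGorensteinProjective_iff] at hX
  refine (toK_map_eq_zero_iff Φ).2 fun n => ?_
  -- A map that is zero on cohomology sends cocycles to boundaries, and the target has none but
  -- zero.
  obtain ⟨ψ, hψ⟩ := exists_factor_of_cocycles hX.1 (i := n) rfl (Φ.f n).hom fun x hx => by
    obtain ⟨y, hy⟩ := exists_of_coh_map_eq_zero Φ n (h n) x hx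
    exact hy.symm
  exact ⟨ObjectProperty.homMk ψ, ObjectProperty.hom_ext _ hψ⟩

end Detection

/-! ### Degreewise split sequences and closure properties -/

section DegreewiseSplit

variable {R : Type u} [Ring R]

/-- Degreewise splittings of a short complex of complexes. -/
abbrev DegreewiseSplitting (E : ShortComplex (ProjCx R)) :=
  ∀ n, (E.map (HomologicalComplex.eval (ProjCat R) (ComplexShape.up ℤ) n)).Splitting

variable {E : ShortComplex (ProjCx R)} (σ : DegreewiseSplitting E)

/-- The degreewise retractions. -/
def retr (n : ℤ) : E.X₂.X n ⟶ E.X₁.X n := (σ n).r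

/-- The degreewise sections. -/
def sect (n : ℤ) : E.X₃.X n ⟶ E.X₂.X n := (σ n).s

theorem f_retr (n : ℤ) : E.f.f n ≫ retr σ n = 𝟙 _ := (σ n).f_r

theorem f_retr_apply (n : ℤ) (x : (E.X₁.X n).obj) :
    (retr σ n).hom ((E.f.f n).hom x) = x :=
  congrArg (fun f => f.hom.hom x) (σ n).f_r

theorem sect_g_apply (n : ℤ) (x : (E.X₃.X n).obj) :
    (E.g.f n).hom ((sect σ n).hom x) = x :=
  congrArg (fun f => f.hom.hom x) (σ n).s_g

theorem split_id_apply (n : ℤ) (x : (E.X₂.X n).obj) :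
    (E.f.f n).hom ((retr σ n).hom x) + (sect σ n).hom ((E.g.f n).hom x) = x :=
  congrArg (fun f => f.hom.hom x) (σ n).id

theorem f_g_apply (n : ℤ) (x : (E.X₁.X n).obj) : (E.g.f n).hom ((E.f.f n).hom x) = 0 :=
  congrArg (fun f => (f.f n).hom.hom x) E.zero

theorem cq_toMod_shortExact (σ : DegreewiseSplitting E)
    (hf : ∀ i, Function.Injective ((coh R i).map ((toK R).map E.f)))
    (i : ℤ) : ∃ h : cqMap ((toMod R).map E.f) i ≫ cqMap ((toMod R).map E.g) i = 0,
      (ShortComplex.mk _ _ h).ShortExact := by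
  refine cq_shortExact _ _ (fun n => Function.LeftInverse.injective (g := (retr σ n).hom) (f_retr_apply σ n))
    (fun n x => f_g_apply n x) (fun n x hx => ⟨(retr σ n).hom x, ?_⟩)
    (fun n x => ⟨(sect σ n).hom x, sect_g_apply σ n x⟩) i ((injective_coh_map_iff E.f i).1 (hf i))
  have h := split_id_apply σ n x
  have hx' : (E.g.f n).hom x = 0 := hx
  rw [hx', map_zero, add_zero] at h
  exact h

theorem cq_dual_shortExact (σ : DegreewiseSplitting E)
    (hg : DualInj ((toK R).map E.g)) (i : ℤ) :
    ∃ h : cqMap (dualMap E.g) i ≫ cqMap (dualMap E.f) i = 0,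
      (ShortComplex.mk _ _ h).ShortExact := by
  refine cq_shortExact _ _ (fun n φ ψ h => ?_) (fun n φ => ?_) (fun n φ hφ => ?_)
    (fun n φ => ?_) i ?_
  · refine LinearMap.ext fun (x : (E.X₃.X (-n)).obj) => ?_
    have := congrArg (fun f : (E.X₂.X (-n)).obj →ₗ[Rᵐᵒᵖ] R => f ((sect σ (-n)).hom x)) h
    let φ' : (E.X₃.X (-n)).obj →ₗ[Rᵐᵒᵖ] R := φ
    let ψ' : (E.X₃.X (-n)).obj →ₗ[Rᵐᵒᵖ] R := ψ
    change φ' ((E.g.f (-n)).hom ((sect σ (-n)).hom x)) =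
      ψ' ((E.g.f (-n)).hom ((sect σ (-n)).hom x)) at this
    rw [sect_g_apply] at this
    exact this
  · refine LinearMap.ext fun (x : (E.X₁.X (-n)).obj) => ?_
    let φ' : (E.X₃.X (-n)).obj →ₗ[Rᵐᵒᵖ] R := φ
    exact (congrArg φ' (f_g_apply (-n) x)).trans (map_zero φ')
  · refine ⟨transpose (sect σ (-n)).hom φ, LinearMap.ext fun (x : (E.X₂.X (-n)).obj) => ?_⟩
    let φ' : (E.X₂.X (-n)).obj →ₗ[Rᵐᵒᵖ] R := φ
    have h : φ' ((E.f.f (-n)).hom ((retr σ (-n)).hom x)) = 0 :=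
      congrArg (fun f : (E.X₁.X (-n)).obj →ₗ[Rᵐᵒᵖ] R => f ((retr σ (-n)).hom x)) hφ
    have h' := congrArg φ' (split_id_apply σ (-n) x)
    rw [map_add, h, zero_add] at h'
    exact h'
  · refine ⟨transpose (retr σ (-n)).hom φ, LinearMap.ext fun (x : (E.X₁.X (-n)).obj) => ?_⟩
    let φ' : (E.X₁.X (-n)).obj →ₗ[Rᵐᵒᵖ] R := φ
    exact congrArg φ' (f_retr_apply σ (-n) x)
  · rintro φ hφ ⟨ψ, hψ⟩
    obtain ⟨χ, hχ⟩ := hg.exists_factor (k := -i) (j := -(i - 1)) (by omega)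
      (ObjectProperty.homMk (ModuleCat.ofHom φ)) (fun l hl => by
        obtain rfl : l = -(i + 1) := by omega
        exact ObjectProperty.hom_ext _ (ModuleCat.hom_ext hφ))
      (ObjectProperty.homMk (ModuleCat.ofHom ψ))
      (ObjectProperty.hom_ext _ (ModuleCat.hom_ext hψ))
    exact ⟨χ.hom.hom, congrArg (fun f => f.hom.hom) hχ⟩

theorem isGorensteinProjective_mid (σ : DegreewiseSplitting E)
    (hf : ∀ i, Function.Injective ((coh R i).map ((toK R).map E.f)))
    (hg : DualInj ((toK R).map E.g)) (h₁ : IsGorensteinProjective ((toK R).obj E.X₁))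
    (h₃ : IsGorensteinProjective ((toK R).obj E.X₃)) :
    IsGorensteinProjective ((toK R).obj E.X₂) := by
  rw [isGorensteinProjective_iff] at *
  constructor <;> intro i
  · obtain ⟨_, h⟩ := cq_toMod_shortExact σ hf i
    exact ExtVanish.mid h (h₁.1 i) (h₃.1 i)
  · obtain ⟨_, h⟩ := cq_dual_shortExact σ hg i
    exact ExtVanish.mid h (h₃.2 i) (h₁.2 i)

/-- In the dual sequence `E.X₃` supplies the kernel term, so that half is formal. The other half
needs functionals on `Cⁱ(E.X₁)` to extend to `Cⁱ(E.X₂)`, which is where `hf'` enters. -/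
theorem isGorensteinProjective_right (σ : DegreewiseSplitting E)
    (hf : ∀ i, Function.Injective ((coh R i).map ((toK R).map E.f)))
    (hf' : DualSurj ((toK R).map E.f)) (hg : DualInj ((toK R).map E.g))
    (h₁ : IsGorensteinProjective ((toK R).obj E.X₁))
    (h₂ : IsGorensteinProjective ((toK R).obj E.X₂)) :
    IsGorensteinProjective ((toK R).obj E.X₃) := by
  rw [isGorensteinProjective_iff] at *
  constructor <;> intro i
  · obtain ⟨_, h⟩ := cq_toMod_shortExact σ hf i
    refine ExtVanish.right h (h₁.1 i) (h₂.1 i) fun φ => ?_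
    let φ' : E.X₁.X i ⟶ regularObj R := ObjectProperty.homMk
      (ModuleCat.ofHom (LinearMap.range (((toMod R).obj E.X₁).d (i - 1) i).hom).mkQ ≫ φ)
    obtain ⟨ψ, θ, hψ, hθ⟩ := hf'.exists_extension i φ' fun l hl => by
      obtain rfl : l = i - 1 := by omega
      ext x
      have : (Submodule.Quotient.mk ((E.X₁.d (i - 1) i).hom x) : cq ((toMod R).obj E.X₁) i) = 0 :=
        (Submodule.Quotient.mk_eq_zero _).2 ⟨x, rfl⟩
      exact (congrArg φ this).trans (map_zero φ.hom)
    -- `ψ` restricts to `φ'` only up to `d ≫ θ`. The added term restricts to `d ≫ θ` and still kills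
    -- boundaries.
    let Ψ : E.X₂.X i ⟶ regularObj R := ψ + E.X₂.d i (i + 1) ≫ (retr σ (i + 1)) ≫ θ
    have hΨ : E.X₂.d (i - 1) i ≫ Ψ = 0 := by
      simp [Ψ, hψ (i - 1) (by omega)]
    have hΨ' : E.f.f i ≫ Ψ = φ' := by
      have : E.f.f i ≫ E.X₂.d i (i + 1) ≫ (retr σ (i + 1)) ≫ θ = E.X₁.d i (i + 1) ≫ θ := by
        rw [HomologicalComplex.Hom.comm_assoc, ← Category.assoc (E.f.f (i + 1)), f_retr,
          Category.id_comp]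
      rw [← hθ, ← this]
      exact Preadditive.comp_add _ _ _ _ _ _
    refine ⟨ModuleCat.ofHom ((LinearMap.range (((toMod R).obj E.X₂).d (i - 1) i).hom).liftQ
      Ψ.hom.hom ?_), ?_⟩
    · rintro _ ⟨x, rfl⟩
      exact congrArg (fun f => f.hom.hom x) hΨ
    · ext x
      exact congrArg (fun f => f.hom.hom x) hΨ'
  · obtain ⟨_, h⟩ := cq_dual_shortExact σ hg i
    exact ExtVanish.left h (h₂.2 i) (h₁.2 i)

end DegreewiseSplit

/-! ### Extensions, and embeddings into split complexes -/

section Embedding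

variable {R : Type u} [Ring R]

/-- Evaluation at `x` vanishes on dual cocycles, so `Ext¹`-vanishing factors it through the dual
differential. By reflexivity the factor is evaluation at some `y`, and functionals separate `d y`
from any other element. -/
theorem exists_preimage_of_forall_cocycle {X : ProjCx R}
    (hX : CokerExtVanish (dualCx X) (ModuleCat.of R R)) {l k : ℤ} (hlk : l + 1 = k)
    (x : (X.X k).obj)
    (h : ∀ φ : X.X k ⟶ regularObj R, X.d l k ≫ φ = 0 → φ.hom x = (0 : R)) :
    ∃ y, (X.d l k).hom y = x := by
  obtain ⟨i, rfl⟩ : ∃ i, k = -i := ⟨-k, by simp⟩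
  obtain ⟨j, rfl⟩ : ∃ j, l = -j := ⟨-l, by simp⟩
  let ev : (dualCx X).X i ⟶ ModuleCat.of R R := ModuleCat.ofHom
    { toFun := fun φ : (X.X (-i)).obj →ₗ[Rᵐᵒᵖ] R => φ x
      map_add' := fun _ _ => rfl
      map_smul' := fun _ _ => rfl }
  obtain ⟨Φ, hΦ⟩ := exists_factor_of_cocycles hX (show i + 1 = j by omega) ev fun φ hφ =>
    h (ObjectProperty.homMk (ModuleCat.ofHom φ)) (ObjectProperty.hom_ext _ (ModuleCat.hom_ext hφ))
  obtain ⟨y, hy⟩ := @exists_eval_eq R _ (X.X (-j)).obj _ _ (X.X (-j)).property.1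
    (X.X (-j)).property.2 Φ.hom
  refine ⟨y, @eq_of_forall_dual R _ (X.X (-i)).obj _ _ (X.X (-i)).property.1
    (X.X (-i)).property.2 _ _ fun φ => ?_⟩
  exact (hy (φ ∘ₗ (X.d (-j) (-i)).hom.hom)).symm.trans (congrArg (fun f => f.hom φ) hΦ)

/-- The functionals killing the image of `d` form a submodule of a noetherian left module; a finite
generating family gives the coordinates of `Φ`. -/
theorem exists_generating_cocycle [IsNoetherianRing R] {M N : ProjCat R} (d : M ⟶ N) :
    ∃ (k : ℕ) (Φ : N ⟶ freeObj R k), d ≫ Φ = 0 ∧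
      ∀ φ : N ⟶ regularObj R, d ≫ φ = 0 → ∃ a : freeObj R k ⟶ regularObj R, Φ ≫ a = φ := by
  have := @isNoetherian_dual R _ N.obj _ _ _ N.property.1
  obtain ⟨k, v, hv⟩ := Submodule.fg_iff_exists_fin_generating_family.1
    (IsNoetherian.noetherian (LinearMap.ker (transpose d.hom).hom))
  refine ⟨k, ObjectProperty.homMk (ModuleCat.ofHom (LinearMap.pi v)), ?_, fun φ hφ => ?_⟩
  · ext x
    refine funext fun i => ?_
    have hi : v i ∈ LinearMap.ker (transpose d.hom).hom := hv ▸ Submodule.subset_span ⟨i, rfl⟩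
    exact congrArg (fun f : M.obj →ₗ[Rᵐᵒᵖ] R => f x) hi
  · let φ₀ : ModuleCat.of R (N.obj →ₗ[Rᵐᵒᵖ] R) := φ.hom.hom
    have hφ' : φ₀ ∈ LinearMap.ker (transpose d.hom).hom :=
      LinearMap.ext fun x => congrArg (fun f => f.hom.hom x) hφ
    rw [← hv, Submodule.mem_span_range_iff_exists_fun] at hφ'
    obtain ⟨c, hc⟩ := hφ'
    let a : (Fin k → R) →ₗ[Rᵐᵒᵖ] R :=
      { toFun := fun x => ∑ i, c i * x i
        map_add' := fun x y => by simp [mul_add, Finset.sum_add_distrib]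
        map_smul' := fun r x => by simp [Finset.sum_mul, mul_assoc] }
    refine ⟨ObjectProperty.homMk (ModuleCat.ofHom a), ?_⟩
    ext x
    refine Eq.trans ?_ (congrArg (fun f : N.obj →ₗ[Rᵐᵒᵖ] R => f x) hc)
    change ∑ i, c i * v i x = _
    simp

theorem DualInj.of_iso {A B A' B' : KProj R} {f : A ⟶ B} {f' : A' ⟶ B'} (a : A ⟶ A')
    (b : B ≅ B') (h : a ≫ f' = f ≫ b.hom) (hf : DualInj f) : DualInj f' := by
  intro φ hφ
  have h0 := hf (b.hom ≫ φ) (by rw [← Category.assoc, ← h, Category.assoc, hφ, comp_zero])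
  rw [← cancel_epi b.hom, h0, comp_zero]

theorem DualSurj.of_iso {A B A' B' : KProj R} {f : A ⟶ B} {f' : A' ⟶ B'} (a : A ≅ A')
    (b : B ≅ B') (h : a.hom ≫ f' = f ≫ b.hom) (hf : DualSurj f) : DualSurj f' := by
  intro φ
  obtain ⟨ψ, hψ⟩ := hf (a.hom ≫ φ)
  refine ⟨b.inv ≫ ψ, ?_⟩
  rw [← cancel_epi a.hom, ← hψ, ← Category.assoc, h]
  simp

theorem coh_injective_of_iso {A B A' B' : KProj R} {f : A ⟶ B} {f' : A' ⟶ B'} (a : A ≅ A')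
    (b : B ≅ B') (h : a.hom ≫ f' = f ≫ b.hom) (i : ℤ)
    (hf : Function.Injective ((coh R i).map f)) : Function.Injective ((coh R i).map f') := by
  rw [← ModuleCat.mono_iff_injective] at hf ⊢
  have : f' = a.inv ≫ f ≫ b.hom := by rw [← h, Iso.inv_hom_id_assoc]
  rw [this, Functor.map_comp, Functor.map_comp]
  infer_instance

variable {A B C : KProj R} {f : A ⟶ B} {g : B ⟶ C} {h : C ⟶ A⟦(1 : ℤ)⟧}

/-- Gorenstein projective complexes are closed under extensions by cohomologically ghost
triangles. -/
theorem isGorensteinProjective_of_extension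
    (hT : Pretriangulated.Triangle.mk f g h ∈ distTriang (KProj R))
    (hf : ∀ i, Function.Injective ((coh R i).map f)) (hg : CohSurjective g)
    (hA : IsGorensteinProjective A) (hC : IsGorensteinProjective C) :
    IsGorensteinProjective B := by
  -- `g` is epi on cohomology, so `φ` vanishes there, and cohomology detects such maps out of a
  -- Gorenstein projective complex.
  have hg' : DualInj g := fun φ hφ => eq_zero_of_coh_map_eq_zero hC φ fun i => by
    have : Epi ((coh R i).map g) := (ModuleCat.epi_iff_surjective _).2 (hg i)
    rw [← cancel_epi ((coh R i).map g), ← Functor.map_comp, hφ, comp_zero]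
    exact (coh R i).map_zero _ _
  obtain ⟨E, σ, ⟨e⟩⟩ :=
    (HomotopyCategory.distinguished_iff_iso_trianglehOfDegreewiseSplit _).1 hT
  let e₁ : A ≅ (toK R).obj E.X₁ := Pretriangulated.Triangle.π₁.mapIso e
  let e₂ : B ≅ (toK R).obj E.X₂ := Pretriangulated.Triangle.π₂.mapIso e
  let e₃ : C ≅ (toK R).obj E.X₃ := Pretriangulated.Triangle.π₃.mapIso e
  have c₁ : f ≫ e₂.hom = e₁.hom ≫ (toK R).map E.f := e.hom.comm₁
  have c₂ : g ≫ e₃.hom = e₂.hom ≫ (toK R).map E.g := e.hom.comm₂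
  exact isGorensteinProjective_of_iso e₂ (isGorensteinProjective_mid σ
    (fun i => coh_injective_of_iso e₁ e₂ c₁.symm i (hf i)) (hg'.of_iso e₂.hom e₃ c₂.symm)
    (isGorensteinProjective_of_iso e₁.symm hA) (isGorensteinProjective_of_iso e₃.symm hC))

theorem isGorensteinProjective_of_cosyzygy
    (hT : Pretriangulated.Triangle.mk f g h ∈ distTriang (KProj R))
    (hf : ∀ i, Function.Injective ((coh R i).map f)) (hf' : DualSurj f)
    (hA : IsGorensteinProjective A) (hB : IsGorensteinProjective B) :
    IsGorensteinProjective C := by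
  have hg := hf'.dualInj hT
  obtain ⟨E, σ, ⟨e⟩⟩ :=
    (HomotopyCategory.distinguished_iff_iso_trianglehOfDegreewiseSplit _).1 hT
  let e₁ : A ≅ (toK R).obj E.X₁ := Pretriangulated.Triangle.π₁.mapIso e
  let e₂ : B ≅ (toK R).obj E.X₂ := Pretriangulated.Triangle.π₂.mapIso e
  let e₃ : C ≅ (toK R).obj E.X₃ := Pretriangulated.Triangle.π₃.mapIso e
  have c₁ : f ≫ e₂.hom = e₁.hom ≫ (toK R).map E.f := e.hom.comm₁
  have c₂ : g ≫ e₃.hom = e₂.hom ≫ (toK R).map E.g := e.hom.comm₂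
  exact isGorensteinProjective_of_iso e₃ (isGorensteinProjective_right σ
    (fun i => coh_injective_of_iso e₁ e₂ c₁.symm i (hf i)) (hf'.of_iso e₁ e₂ c₁.symm)
    (hg.of_iso e₂.hom e₃ c₂.symm)
    (isGorensteinProjective_of_iso e₁.symm hA) (isGorensteinProjective_of_iso e₂.symm hB))

/-- A Gorenstein projective complex embeds, by a cohomologically ghost triangle, in a split complex
with Gorenstein projective cone. -/
theorem exists_split_embedding [IsNoetherianRing R] {G : KProj R}
    (hG : IsGorensteinProjective G) :
    ∃ (P G' : KProj R) (f : G ⟶ P) (g : P ⟶ G') (h : G' ⟶ G⟦(1 : ℤ)⟧),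
      Pretriangulated.Triangle.mk f g h ∈ distTriang (KProj R) ∧ IsSplit P ∧
        IsGorensteinProjective G' ∧ ∀ i, Function.Injective ((coh R i).map f) := by
  obtain ⟨G, rfl⟩ := HomotopyCategory.quotient_obj_surjective G
  choose k Φ hΦ hΦ' using fun n => exists_generating_cocycle (G.d (n - 1) n)
  let F : G ⟶ zeroD fun n => freeObj R (k n) := toZeroD Φ fun i j hij => by
    obtain rfl : i = j - 1 := by omega
    exact hΦ j
  obtain ⟨G', g, h, hT⟩ := Pretriangulated.distinguished_cocone_triangle ((toK R).map F)
  -- Each component of a map to `regularCx R` is a dual cocycle, hence a combination of the chosen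
  -- generators.
  have hsurj : DualSurj ((toK R).map F) := by
    intro φ
    obtain ⟨φ, rfl⟩ := (toK R).map_surjective φ
    choose a ha using fun n => hΦ' n (φ.f n) ((φ.comm (n - 1) n).symm.trans comp_zero)
    refine ⟨(toK R).map (toZeroD a fun _ _ _ => zero_comp), ?_⟩
    rw [← Functor.map_comp]
    congr 1
    ext n : 1
    exact ha n
  have hinj : ∀ i, Function.Injective ((coh R i).map ((toK R).map F)) := by
    intro i
    rw [injective_coh_map_iff]
    rintro x - ⟨y, hy⟩
    -- The only boundary in the target is zero, so all generating dual cocycles, and then all dual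
    -- cocycles, vanish at `x`.
    have hx : (Φ i).hom x = 0 := hy.symm
    refine exists_preimage_of_forall_cocycle ((isGorensteinProjective_iff G).1 hG).2
      (sub_add_cancel i 1) x fun φ hφ => ?_
    obtain ⟨a, rfl⟩ := hΦ' i φ hφ
    exact (congrArg a.hom hx).trans (map_zero a.hom.hom)
  exact ⟨_, G', _, g, h, hT, isSplit_zeroD _, isGorensteinProjective_of_cosyzygy hT hinj hsurj hG
    (isGorensteinProjective_of_isSplit (isSplit_zeroD _)), hinj⟩

end Embedding

/-! ### Ghost triangles as triangles whose connecting map is a ghost -/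

section Ghost

variable {R : Type u} [Ring R]

/-- Shifting a complex shifts its cohomology. -/
def cohShiftIso (R : Type u) [Ring R] (n i j : ℤ) (h : n + i = j) :
    shiftFunctor (KProj R) n ⋙ coh R i ≅ coh R j :=
  (Functor.associator _ _ _).symm ≪≫
    Functor.isoWhiskerRight (((incl R).mapHomotopyCategory (ComplexShape.up ℤ)).commShiftIso n) _ ≪≫
    Functor.associator _ _ _ ≪≫
    Functor.isoWhiskerLeft ((incl R).mapHomotopyCategory (ComplexShape.up ℤ))
      ((HomotopyCategory.homologyFunctor (ModuleCat.{u} Rᵐᵒᵖ) (ComplexShape.up ℤ) 0).shiftIso n i j h)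

/-- A morphism is a ghost if it induces zero on cohomology. -/
def IsGhost {X Y : KProj R} (f : X ⟶ Y) : Prop := ∀ i, (coh R i).map f = 0

variable {X Y Z : KProj R}

theorem IsGhost.comp_right {f : X ⟶ Y} (hf : IsGhost f) (g : Y ⟶ Z) : IsGhost (f ≫ g) :=
  fun i => by rw [Functor.map_comp, hf i, zero_comp]

theorem IsGhost.shift {f : X ⟶ Y} (hf : IsGhost f) (n : ℤ) : IsGhost (f⟦n⟧') := by
  intro i
  refine (NatIso.naturality_2 (cohShiftIso R n i _ rfl) f).symm.trans ?_
  rw [hf, zero_comp, comp_zero]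

variable {A B C : KProj R} {f : A ⟶ B} {g : B ⟶ C} {h : C ⟶ A⟦(1 : ℤ)⟧}

theorem isGhost_of_cohSurjective (hT : Pretriangulated.Triangle.mk f g h ∈ distTriang (KProj R))
    (hg : CohSurjective g) : IsGhost h := by
  intro i
  have : Epi ((coh R i).map g) := (ModuleCat.epi_iff_surjective _).2 (hg i)
  have h0 : g ≫ h = 0 := Pretriangulated.comp_distTriang_mor_zero₂₃ _ hT
  rw [← cancel_epi ((coh R i).map g), ← Functor.map_comp, h0, comp_zero, Functor.map_zero]

theorem isGhost_of_injective (hT : Pretriangulated.Triangle.mk f g h ∈ distTriang (KProj R))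
    (hf : ∀ i, Function.Injective ((coh R i).map f)) : IsGhost h := by
  intro i
  have : Mono ((coh R (1 + i)).map f) := (ModuleCat.mono_iff_injective _).2 (hf _)
  have : Mono ((coh R i).map (f⟦(1 : ℤ)⟧')) :=
    ((MorphismProperty.monomorphisms _).arrow_mk_iso_iff
      (((Functor.mapArrowFunctor _ _).mapIso (cohShiftIso R 1 i _ rfl)).app (Arrow.mk f))).2 this
  have h0 : h ≫ f⟦(1 : ℤ)⟧' = 0 := Pretriangulated.comp_distTriang_mor_zero₃₁ _ hT
  rw [← cancel_mono ((coh R i).map (f⟦(1 : ℤ)⟧')), ← Functor.map_comp, h0, zero_comp,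
    Functor.map_zero]

theorem cohSurjective_of_isGhost (hT : Pretriangulated.Triangle.mk f g h ∈ distTriang (KProj R))
    (hh : IsGhost h) : CohSurjective g := by
  intro i
  have := (coh R i).map_distinguished_exact _ (Pretriangulated.rot_of_distTriang _ hT)
  exact (ModuleCat.epi_iff_surjective _).1 (this.epi_f (hh i))

theorem coh_injective_of_isGhost (hT : Pretriangulated.Triangle.mk f g h ∈ distTriang (KProj R))
    (hh : IsGhost h) (i : ℤ) : Function.Injective ((coh R i).map f) := by
  have := (coh R i).map_distinguished_exact _ (Pretriangulated.inv_rot_of_distTriang _ hT)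
  refine (ModuleCat.mono_iff_injective _).1 (this.mono_g ?_)
  exact (Functor.map_neg _).trans
    ((congrArg Neg.neg ((hh.shift (-1)).comp_right _ i)).trans neg_zero)

theorem isCohGhostTriangle_of_isGhost
    (hT : Pretriangulated.Triangle.mk f g h ∈ distTriang (KProj R)) (hh : IsGhost h) :
    IsCohGhostTriangle f g h :=
  ⟨hT, fun i => ⟨coh_injective_of_isGhost hT hh i,
    (ShortComplex.ShortExact.moduleCat_exact_iff_function_exact _).1
      ((coh R i).map_distinguished_exact _ hT), cohSurjective_of_isGhost hT hh i⟩⟩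

end Ghost

/-! ### Resolutions and Gorenstein projective approximations -/

section Resolutions

variable {R : Type u} [Ring R] {P Q : KProj R → Prop} {X Y G : KProj R}

theorem HasResolution.mono (hPQ : ∀ X, P X → Q X) {n : ℕ} (h : HasResolution P X n) :
    HasResolution Q X n := by
  obtain ⟨Z, e, hn, hZ⟩ := h
  refine ⟨Z, e, hPQ _ hn, fun i hi => ?_⟩
  obtain ⟨G, a, b, c, hG, h⟩ := hZ i hi
  exact ⟨G, a, b, c, hPQ _ hG, h⟩

theorem HasResolution.cons {f : Y ⟶ G} {g : G ⟶ X} {h : X ⟶ Y⟦(1 : ℤ)⟧}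
    (hT : Pretriangulated.Triangle.mk f g h ∈ distTriang (KProj R)) (hg : CohSurjective g)
    (hG : P G) {n : ℕ} (hY : HasResolution P Y n) : HasResolution P X (n + 1) := by
  obtain ⟨Z, ⟨e⟩, hn, hZ⟩ := hY
  refine ⟨fun k => Nat.casesOn k X Z, ⟨Iso.refl _⟩, hn, fun i hi => ?_⟩
  cases i with
  | zero =>
    refine ⟨G, e.hom ≫ f, g, h ≫ e.inv⟦(1 : ℤ)⟧', hG, ?_, hg⟩
    refine Pretriangulated.isomorphic_distinguished _ hT _
      (Pretriangulated.Triangle.isoMk _ _ e (Iso.refl _) (Iso.refl _) ?_ ?_ ?_)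
    · exact Category.comp_id _
    · exact (Category.comp_id _).trans (Category.id_comp _).symm
    · change (h ≫ e.inv⟦(1 : ℤ)⟧') ≫ e.hom⟦(1 : ℤ)⟧' = 𝟙 X ≫ h
      rw [Category.assoc, ← Functor.map_comp, e.inv_hom_id, CategoryTheory.Functor.map_id, Category.comp_id,
        Category.id_comp]
  | succ i => exact hZ i (by omega)

theorem HasResolution.uncons {n : ℕ} (hX : HasResolution P X (n + 1)) :
    ∃ (Y G : KProj R) (f : Y ⟶ G) (g : G ⟶ X) (h : X ⟶ Y⟦(1 : ℤ)⟧), P G ∧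
      Pretriangulated.Triangle.mk f g h ∈ distTriang (KProj R) ∧ CohSurjective g ∧
        HasResolution P Y n := by
  obtain ⟨Z, ⟨e⟩, hn, hZ⟩ := hX
  obtain ⟨G, a, b, c, hG, hT, hb⟩ := hZ 0 (Nat.succ_pos n)
  refine ⟨Z 1, G, a, b ≫ e.hom, e.inv ≫ c, hG, ?_, fun i => ?_, fun k => Z (k + 1),
    ⟨Iso.refl _⟩, hn, fun i hi => hZ (i + 1) (by omega)⟩
  · refine Pretriangulated.isomorphic_distinguished _ hT _
      (Pretriangulated.Triangle.isoMk _ _ (Iso.refl _) (Iso.refl _) e.symm ?_ ?_ ?_)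
    · exact (Category.comp_id _).trans (Category.id_comp _).symm
    · change (b ≫ e.hom) ≫ e.inv = 𝟙 G ≫ b
      simp
    · change (e.inv ≫ c) ≫ (𝟙 (Z 1))⟦(1 : ℤ)⟧' = e.inv ≫ c
      simp
  · have : Epi ((coh R i).map b) := (ModuleCat.epi_iff_surjective _).2 (hb i)
    rw [← ModuleCat.epi_iff_surjective, Functor.map_comp]
    infer_instance

theorem projDim_lt_top_iff (X : KProj R) : projDim X < ⊤ ↔ ∃ n, HasResolution IsSplit X n := by
  simp [projDim, sInf_lt_iff]

theorem gorensteinDim_lt_top_iff (X : KProj R) :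
    gorensteinDim X < ⊤ ↔ ∃ n, HasResolution IsGorensteinProjective X n := by
  simp [gorensteinDim, sInf_lt_iff]

theorem neg_comp_eq_neg_comp {C : Type*} [Category* C] [Preadditive C] {A B B' D D' : C}
    (a : A ⟶ B) {b : B ⟶ B'} {d : B ⟶ D} {d' : B' ⟶ D'} {m : D ⟶ D'} (h : b ≫ d' = d ≫ m) :
    (-a ≫ d) ≫ m = -(a ≫ b) ≫ d' := by
  simp [h]

/-- A complex of finite Gorenstein dimension has a Gorenstein projective approximation with kernel
of finite projective dimension. -/
theorem exists_gorensteinProjective_approximation [IsNoetherianRing R] (n : ℕ) (X : KProj R)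
    (hX : HasResolution IsGorensteinProjective X n) :
    ∃ (Y G : KProj R) (f : Y ⟶ G) (g : G ⟶ X) (h : X ⟶ Y⟦(1 : ℤ)⟧),
      IsCohGhostTriangle f g h ∧ (∃ m, HasResolution IsSplit Y m) ∧
        IsGorensteinProjective G := by
  induction n generalizing X with
  | zero =>
    obtain ⟨Z, ⟨e⟩, hZ, -⟩ := hX
    let O : KProj R := (toK R).obj (zeroD fun _ => 0)
    have hO : IsZero O := (toK R).map_isZero <| (IsZero.iff_id_eq_zero _).2 <| by
      ext n : 1
      exact (isZero_zero (ProjCat R)).eq_of_src _ _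
    -- In length zero `X` approximates itself, with zero kernel.
    refine ⟨O, X, 0, 𝟙 X, 0, isCohGhostTriangle_of_isGhost ?_ fun i => Functor.map_zero _ _ _,
      ⟨0, fun _ => O, ⟨Iso.refl _⟩, isSplit_zeroD _, fun i hi => by omega⟩,
      isGorensteinProjective_of_iso e.symm hZ⟩
    refine Pretriangulated.isomorphic_distinguished _
      (Pretriangulated.contractible_distinguished₁ X) _
      (Pretriangulated.Triangle.isoMk _ _ (hO.iso (isZero_zero _)) (Iso.refl _) (Iso.refl _)
        (hO.eq_of_src _ _) rfl ?_)
    exact zero_comp.trans comp_zero.symm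
  | succ n ih =>
    obtain ⟨X₁, G₀, a, b, c, hG₀, hT, hb, hX₁⟩ := hX.uncons
    obtain ⟨Y₁, G₁, u, v, w, ⟨hT₁, hex⟩, ⟨m, hY₁⟩, hG₁⟩ := ih X₁ hX₁
    obtain ⟨P, G', p, q, r, hT₂, hP, hG', hp⟩ := exists_split_embedding hG₁
    obtain ⟨W, s, t, hT₃⟩ := Pretriangulated.distinguished_cocone_triangle (u ≫ p)
    -- For `Y₁ → G₁ → P`: this gives `X₁ → W → G'` with connecting map `r ≫ v⟦1⟧'`, a ghost because
    -- `r` is.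
    let O₁ := Triangulated.someOctahedron rfl hT₁ hT₂ hT₃
    have hup : ∀ i, Function.Injective ((coh R i).map (u ≫ p)) := fun i => by
      have : Mono ((coh R i).map u) := (ModuleCat.mono_iff_injective _).2 (hex i).1
      have : Mono ((coh R i).map p) := (ModuleCat.mono_iff_injective _).2 (hp i)
      rw [← ModuleCat.mono_iff_injective, Functor.map_comp]
      infer_instance
    have hW : HasResolution IsSplit W (m + 1) :=
      hY₁.cons hT₃ (cohSurjective_of_isGhost hT₃ (isGhost_of_injective hT₃ hup)) hP
    have hr : IsGhost r := isGhost_of_injective hT₂ hp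
    have hc : IsGhost c := isGhost_of_cohSurjective hT hb
    -- `E` is the homotopy pushout of `G₀` along `X₁ → W`, built by prescribing the connecting map.
    obtain ⟨E, f, g, hT₄⟩ :=
      Pretriangulated.distinguished_cocone_triangle₂ (c ≫ O₁.m₁⟦(1 : ℤ)⟧')
    have hcomm : (Pretriangulated.Triangle.mk a b c).invRotate.mor₁ ≫ O₁.m₁ =
        (Pretriangulated.Triangle.mk f g (c ≫ O₁.m₁⟦(1 : ℤ)⟧')).invRotate.mor₁ := by
      change (-c⟦(-1 : ℤ)⟧' ≫ (shiftEquiv (KProj R) (1 : ℤ)).unitIso.inv.app X₁) ≫ O₁.m₁ =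
        -(c ≫ O₁.m₁⟦(1 : ℤ)⟧')⟦(-1 : ℤ)⟧' ≫ (shiftEquiv (KProj R) (1 : ℤ)).unitIso.inv.app W
      rw [Functor.map_comp]
      exact neg_comp_eq_neg_comp _
        ((shiftEquiv (KProj R) (1 : ℤ)).unitIso.inv.naturality O₁.m₁)
    -- For `X⟦-1⟧ → X₁ → W`, with cones `G₀`, `G'` and `E`: this gives `G₀ → E → G'`, whose
    -- connecting map is a ghost.
    let O₂ := Triangulated.someOctahedron hcomm (Pretriangulated.inv_rot_of_distTriang _ hT) O₁.mem
      (Pretriangulated.inv_rot_of_distTriang _ hT₄)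
    have hghost : IsGhost ((r ≫ v⟦(1 : ℤ)⟧') ≫ a⟦(1 : ℤ)⟧') :=
      (hr.comp_right _).comp_right _
    exact ⟨W, E, f, g, _, isCohGhostTriangle_of_isGhost hT₄ (hc.comp_right _), ⟨_, hW⟩,
      isGorensteinProjective_of_extension O₂.mem (coh_injective_of_isGhost O₂.mem hghost)
        (cohSurjective_of_isGhost O₂.mem hghost) hG₀ hG'⟩

end Resolutions

end

end StableComplex

theorem corollary5p13 {R : Type u} [Ring R] [IsNoetherianRing R] [IsNoetherianRing Rᵐᵒᵖ]
    (X : StableComplex.KProj R) :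
    StableComplex.gorensteinDim X < ⊤ ↔
      ∃ (Y G : StableComplex.KProj R) (f : Y ⟶ G) (g : G ⟶ X) (h : X ⟶ Y⟦(1 : ℤ)⟧),
        StableComplex.IsCohGhostTriangle f g h ∧ StableComplex.projDim Y < ⊤ ∧
          StableComplex.IsGorensteinProjective G := by
  simp only [StableComplex.gorensteinDim_lt_top_iff, StableComplex.projDim_lt_top_iff]
  constructor
  · rintro ⟨n, hn⟩
    exact StableComplex.exists_gorensteinProjective_approximation n X hn
  · rintro ⟨Y, G, f, g, h, ⟨hT, hex⟩, ⟨n, hY⟩, hG⟩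
    -- Only surjectivity of `G → X` on cohomology is needed from the ghost condition.
    exact ⟨n + 1, (hY.mono fun _ => StableComplex.isGorensteinProjective_of_isSplit).cons hT
      (fun i => (hex i).2.2) hG⟩
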